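/- Let $a>0$ and let $q_{i,r}\ge 0$ ($i=0,1$; $r=0,1,2$) satisfy $\sum_{r=0}^2 q_{i,r}=1$ for $i=0,1$. For $i=0,1$ let $\mathscr V_i=\{(\tfrac32 aj+ia,\ \tfrac{\sqrt3}{2}aj+\sqrt3ak): j,k\in\mathbb Z\}$; the union $\mathscr V_0\cup\mathscr V_1$ is the vertex set of a hexagonal lattice with distance $a$ between adjacent vertices. Let $(X_n,Y_n)_{n\ge 0}$ be the discrete-time random walk (Markov chain) on $\mathscr V_0\cup\mathscr V_1$ with $\mathbb P[(X_0,Y_0)=(0,0)]=1$ which moves from a vertex $(x,y)\in\mathscr V_i$ to $\left(x+a\cos(\tfrac{2\pi r}{3}+i\pi),\ y+a\sin(\tfrac{2\pi r}{3}+i\pi)\right)$ with probability $q_{i,r}$, $r=0,1,2$. Put $$\sigma_1^2=\tfrac98a^2\left[(q_{0,1}+q_{0,2})-(q_{0,1}+q_{0,2})^2+(q_{1,1}+q_{1,2})-(q_{1,1}+q_{1,2})^2\right],$$ $$\sigma_2^2=\tfrac38a^2\left[(q_{0,1}+q_{0,2})-(q_{0,1}-q_{0,2})^2+(q_{1,1}+q_{1,2})-(q_{1,1}-q_{1,2})^2\right],$$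 $$\sigma_{1,2}=\tfrac{3\sqrt3}{8}a^2\left[q_{0,1}(q_{0,1}-1)+q_{0,2}(1-q_{0,2})-q_{1,1}(1-q_{1,1})+q_{1,2}(1-q_{1,2})\right],$$ and $C=\begin{pmatrix}\sigma_1^2&\sigma_{1,2}\\ \sigma_{1,2}&\sigma_2^2\end{pmatrix}$. Then for every sequence $(a_n)_{n\ge1}$ of positive numbers with $a_n\to0$ and $na_n\to\infty$, the sequence $$Z_n=\sqrt{na_n}\left(\frac{X_n-\mathbb E(X_n)}{n},\frac{Y_n-\mathbb E(Y_n)}{n}\right),\qquad n\ge1,$$ satisfies the large deviation principle on $\mathbb R^2$ with speed $1/a_n$ and good rate function $$\tilde\Lambda^*(x,y)=\sup_{(\lambda_1,\lambda_2)\in\mathbb R^2}\left\{\lambda_1x+\lambda_2y-\tilde\Lambda(\lambda_1,\lambda_2)\right\},\qquad \tilde\Lambda(\lambda_1,\lambda_2)=\tfrac12(\lambda_1,\lambda_2)\,C\binom{\lambda_1}{\lambda_2}.$$ That is, $1/a_n>0$ and $1/a_n\to\infty$; $\tilde\Lambda^*:\mathbb R^2\to[0,\infty]$ is lower semicontinuous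 with compact level sets $\{\tilde\Lambda^*\le\eta\}$, $\eta\ge0$; and, with $\log 0=-\infty$ and $\inf\emptyset=+\infty$, $$\liminf_{n\to\infty}a_n\log\mathbb P(Z_n\in O)\ge-\inf_{z\in O}\tilde\Lambda^*(z)\ \text{ for all open sets } O\subseteq\mathbb R^2,$$ $$\limsup_{n\to\infty}a_n\log\mathbb P(Z_n\in F)\le-\inf_{z\in F}\tilde\Lambda^*(z)\ \text{ for all closed sets } F\subseteq\mathbb R^2.$$ -/

import Mathlib

open MeasureTheory ProbabilityTheory Filter Topology

noncomputable section

/-- The vertex class `𝒱ᵢ` (`i = 0, 1`) of the hexagonal lattice with distance `a` between adjacent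
vertices. -/
def vertexSet (a : ℝ) (i : Fin 2) : Set (ℝ × ℝ) :=
  {p | ∃ j k : ℤ,
    p = (3 / 2 * a * (j : ℝ) + ((i : ℕ) : ℝ) * a,
      √3 / 2 * a * (j : ℝ) + √3 * a * (k : ℝ))}

/-- The displacement number `r` (`r = 0, 1, 2`) from a vertex of class `𝒱ᵢ` to an adjacent vertex:
`a (cos (2πr/3 + iπ), sin (2πr/3 + iπ))`. -/
def hexStep (a : ℝ) (i : Fin 2) (r : Fin 3) : ℝ × ℝ :=
  (a * Real.cos (((r : ℕ) : ℝ) * (2 / 3 * Real.pi) + ((i : ℕ) : ℝ) * Real.pi),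
    a * Real.sin (((r : ℕ) : ℝ) * (2 / 3 * Real.pi) + ((i : ℕ) : ℝ) * Real.pi))

/-- `(Xₙ, Yₙ)` is the random walk (discrete-time Markov chain) on the hexagonal lattice started at
the origin, which moves from a vertex of class `𝒱ᵢ` by the displacement `hexStep a i r` with
probability `q i r`, whatever its past. -/
structure IsHexWalk {Ω : Type*} [MeasurableSpace Ω] (P : Measure Ω)
    (a : ℝ) (q : Fin 2 → Fin 3 → ℝ) (X Y : ℕ → Ω → ℝ) : Prop where
  measurable_fst : ∀ n, Measurable (X n)
  measurable_snd : ∀ n, Measurable (Y n)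
  initial : P {ω | (X 0 ω, Y 0 ω) = (0, 0)} = 1
  transition : ∀ (n : ℕ) (s : ℕ → ℝ × ℝ) (i : Fin 2) (r : Fin 3),
    s n ∈ vertexSet a i →
    P {ω | ∀ k ≤ n, (X k ω, Y k ω) = s k} ≠ 0 →
    ProbabilityTheory.cond P {ω | ∀ k ≤ n, (X k ω, Y k ω) = s k}
      {ω | (X (n + 1) ω, Y (n + 1) ω) = s n + hexStep a i r} = ENNReal.ofReal (q i r)

/-- A speed: `vₙ > 0` for `n ≥ 1` and `vₙ → ∞`. -/
structure IsSpeed (v : ℕ → ℝ) : Prop where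
  pos : ∀ n, 1 ≤ n → 0 < v n
  tendsto : Tendsto v atTop atTop

/-- A rate function: lower semicontinuous with values in `[0, ∞]`. -/
structure IsRateFunction {E : Type*} [TopologicalSpace E] (I : E → EReal) : Prop where
  nonneg : ∀ z, 0 ≤ I z
  lowerSemicontinuous : LowerSemicontinuous I

/-- A good rate function: a rate function with compact level sets. -/
structure IsGoodRateFunction {E : Type*} [TopologicalSpace E] (I : E → EReal) : Prop
    extends IsRateFunction I where
  isCompact_level : ∀ η : ℝ, 0 ≤ η → IsCompact {z | I z ≤ (η : EReal)}

/-- The large deviation principle for the sequence `(Zₙ)_{n ≥ 1}` with speed `v` and rate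
function `I`. The logarithm is extended-real valued, with `log 0 = -∞`. -/
structure SatisfiesLDP {Ω : Type*} [MeasurableSpace Ω] (P : Measure Ω)
    {E : Type*} [TopologicalSpace E] (Z : ℕ → Ω → E) (v : ℕ → ℝ) (I : E → EReal) : Prop where
  isSpeed : IsSpeed v
  isRateFunction : IsRateFunction I
  lower_bound : ∀ O : Set E, IsOpen O →
    -(⨅ z ∈ O, I z) ≤
      liminf (fun n : ℕ => ((1 / v n : ℝ) : EReal) * ENNReal.log (P (Z n ⁻¹' O))) atTop
  upper_bound : ∀ F : Set E, IsClosed F →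
    limsup (fun n : ℕ => ((1 / v n : ℝ) : EReal) * ENNReal.log (P (Z n ⁻¹' F))) atTop ≤
      -(⨅ z ∈ F, I z)

/-- The entry `σ₁²` of the asymptotic covariance matrix. -/
def sigmaSqX (a : ℝ) (q : Fin 2 → Fin 3 → ℝ) : ℝ :=
  9 / 8 * a ^ 2 * ((q 0 1 + q 0 2) - (q 0 1 + q 0 2) ^ 2 + (q 1 1 + q 1 2) - (q 1 1 + q 1 2) ^ 2)

/-- The entry `σ₂²` of the asymptotic covariance matrix. -/
def sigmaSqY (a : ℝ) (q : Fin 2 → Fin 3 → ℝ) : ℝ :=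
  3 / 8 * a ^ 2 * ((q 0 1 + q 0 2) - (q 0 1 - q 0 2) ^ 2 + (q 1 1 + q 1 2) - (q 1 1 - q 1 2) ^ 2)

/-- The entry `σ₁,₂` of the asymptotic covariance matrix. -/
def sigmaXY (a : ℝ) (q : Fin 2 → Fin 3 → ℝ) : ℝ :=
  3 * (√3 / 8) * a ^ 2 *
    (q 0 1 * (q 0 1 - 1) + q 0 2 * (1 - q 0 2) - q 1 1 * (1 - q 1 1) + q 1 2 * (1 - q 1 2))

/-- The asymptotic covariance matrix `C`. -/
def covMatrix (a : ℝ) (q : Fin 2 → Fin 3 → ℝ) : Matrix (Fin 2) (Fin 2) ℝ :=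
  !![sigmaSqX a q, sigmaXY a q; sigmaXY a q, sigmaSqY a q]

/-- The quadratic form `½ (λ₁, λ₂) C (λ₁, λ₂)ᵀ`. -/
def quadForm (C : Matrix (Fin 2) (Fin 2) ℝ) (l : ℝ × ℝ) : ℝ :=
  1 / 2 * (![l.1, l.2] ⬝ᵥ C.mulVec ![l.1, l.2])

/-- The Legendre transform on `ℝ²`, with values in the extended reals. -/
def legendre (L : ℝ × ℝ → ℝ) (z : ℝ × ℝ) : EReal :=
  ⨆ l : ℝ × ℝ, ((l.1 * z.1 + l.2 * z.2 - L l : ℝ) : EReal)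

end

/-! The two vertex classes alternate, so the class at time `n` is the parity of `n`. The successive
step numbers are therefore independent, with law `q 0` at even times and `q 1` at odd times, and the
moment generating function of the centred walk is a product of n single-step factors of two kinds
(`integral_exp_centred_walk`). The exponent `pairing l (Z n) / b n` is the centred walk paired with
l and multiplied by σ = 1/√(n b n), which tends to 0. Each factor has logarithm σ² · variance / 2 +
o(σ²) (`tendsto_log_sum_exp_div_sq`), and b n = 1/(n σ²), so the scaled logarithm converges to the
average of the two half-variances. This is the quadratic form of `covMatrix`
(`tendsto_log_mgf_walk`, `quadForm_covMatrix`).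

The LDP then follows from a Gärtner–Ellis argument for a quadratic limit Q. Upper bound: finitely
many half-spaces cover a closed set, each with a Chernoff estimate. Lower bound: under exponential
tilting by l, the mass concentrates near the gradient of Q at l. The matrix may be singular, but
points outside its range have infinite rate and need no estimate (`exists_eq_of_legendre_ne_top`).
-/

noncomputable section

/-! ### Legendre transforms and half-spaces in the plane. -/

/-- The standard pairing on `ℝ²`. -/
def pairing (l z : ℝ × ℝ) : ℝ := l.1 * z.1 + l.2 * z.2

lemma continuous_pairing (l : ℝ × ℝ) : Continuous (pairing l) := by
  unfold pairing; fun_prop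

lemma pairing_sub_le_legendre (L : ℝ × ℝ → ℝ) (l z : ℝ × ℝ) :
    ((pairing l z - L l : ℝ) : EReal) ≤ legendre L z :=
  le_iSup (fun l : ℝ × ℝ => ((pairing l z - L l : ℝ) : EReal)) l

lemma exists_of_lt_legendre {L : ℝ × ℝ → ℝ} {z : ℝ × ℝ} {α : ℝ}
    (h : (α : EReal) < legendre L z) : ∃ l, α < pairing l z - L l := by
  obtain ⟨l, hl⟩ := lt_iSup_iff.1 h
  exact ⟨l, by exact_mod_cast hl⟩

/-- As L is finite at the four covectors ±e₁, ±e₂, a bound on the transform bounds both coordinates,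
so level sets lie in a box. -/
lemma isGoodRateFunction_legendre {L : ℝ × ℝ → ℝ} (h0 : L 0 = 0) :
    IsGoodRateFunction (legendre L) := by
  have hlsc : LowerSemicontinuous (legendre L) := by
    refine lowerSemicontinuous_iSup fun l => Continuous.lowerSemicontinuous ?_
    exact continuous_coe_real_ereal.comp (by fun_prop)
  refine ⟨⟨fun z => ?_, hlsc⟩, fun η _ => ?_⟩
  · have := pairing_sub_le_legendre L 0 z
    simpa [pairing, h0] using this
  · have hb : ∀ l z, legendre L z ≤ (η : EReal) → pairing l z ≤ η + L l := by
      intro l z hz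
      have := (pairing_sub_le_legendre L l z).trans hz
      have : pairing l z - L l ≤ η := by exact_mod_cast this
      linarith
    refine (isCompact_Icc (a := ((-(η + L (-1, 0)), -(η + L (0, -1))) : ℝ × ℝ))
      (b := (η + L (1, 0), η + L (0, 1)))).of_isClosed_subset
      (hlsc.isClosed_preimage (η : EReal)) fun z hz => ?_
    have h1 := hb (1, 0) z hz
    have h2 := hb (-1, 0) z hz
    have h3 := hb (0, 1) z hz
    have h4 := hb (0, -1) z hz
    simp only [pairing] at h1 h2 h3 h4
    refine ⟨⟨?_, ?_⟩, ⟨?_, ?_⟩⟩ <;> simp <;> linarith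

/-- Off a large box one of ±e₁, ±e₂ already works; inside it compactness applies. No separate
exponential tightness argument is needed. -/
lemma exists_finset_halfspace_cover {L : ℝ × ℝ → ℝ} {F : Set (ℝ × ℝ)} (hF : IsClosed F) {α : ℝ}
    (hα : ∀ z ∈ F, (α : EReal) < legendre L z) :
    ∃ T : Finset (ℝ × ℝ), ∀ z ∈ F, ∃ l ∈ T, α < pairing l z - L l := by
  classical
  set B : Set (ℝ × ℝ) := Set.Icc (-(α + L (-1, 0)), -(α + L (0, -1))) (α + L (1, 0), α + L (0, 1))
    with hB
  obtain ⟨T, hT⟩ := ((isCompact_Icc : IsCompact B).inter_right hF).elim_finite_subcover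
    (fun l : ℝ × ℝ => {z | α < pairing l z - L l})
    (fun l => isOpen_lt continuous_const ((continuous_pairing l).sub continuous_const))
    (fun z hz => Set.mem_iUnion.2 (exists_of_lt_legendre (hα z hz.2)))
  refine ⟨T ∪ {(1, 0), (-1, 0), (0, 1), (0, -1)}, fun z hz => ?_⟩
  by_cases hzB : z ∈ B
  · obtain ⟨l, hl, h⟩ := Set.mem_iUnion₂.1 (hT ⟨hzB, hz⟩)
    exact ⟨l, Finset.mem_union_left _ hl, h⟩
  · by_contra! hcon
    have h1 := hcon (1, 0) (by simp)
    have h2 := hcon (-1, 0) (by simp)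
    have h3 := hcon (0, 1) (by simp)
    have h4 := hcon (0, -1) (by simp)
    simp only [pairing] at h1 h2 h3 h4
    refine hzB ⟨⟨?_, ?_⟩, ⟨?_, ?_⟩⟩ <;> simp <;> linarith

/-! ### Logarithmic asymptotics from real exponential bounds. -/

section logarithms

variable {Ω : Type*} [MeasurableSpace Ω] {P : Measure Ω} [IsProbabilityMeasure P]
  {b : ℕ → ℝ} {A : ℕ → Set Ω} {c : ℝ}

/-- The factor `1 / (1 / b n)` is the inverse speed as it appears in `SatisfiesLDP`. Positivity of
`b` is asked only eventually, since nothing is known about `b 0`. -/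
lemma le_liminf_log_measure (hb : ∀ᶠ n in atTop, 0 < b n)
    (h : ∀ η > 0, ∀ᶠ n in atTop, Real.exp ((c - η) / b n) ≤ P.real (A n)) :
    (c : EReal) ≤ liminf (fun n => ((1 / (1 / b n) : ℝ) : EReal) * ENNReal.log (P (A n))) atTop := by
  refine EReal.ge_of_forall_gt_iff_ge.1 fun x hx => ?_
  have hx' : x < c := by exact_mod_cast hx
  refine le_liminf_of_le (by isBoundedDefault) ?_
  filter_upwards [hb, h (c - x) (by linarith)] with n hn hle
  have h1 : ENNReal.ofReal (Real.exp (x / b n)) ≤ P (A n) := by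
    rw [← ofReal_measureReal]
    exact ENNReal.ofReal_le_ofReal (by simpa using hle)
  have h2 : ((x / b n : ℝ) : EReal) ≤ ENNReal.log (P (A n)) := by
    have := ENNReal.log_monotone h1
    rwa [ENNReal.log_ofReal_of_pos (Real.exp_pos _), Real.log_exp] at this
  calc (x : EReal) = ((b n : ℝ) : EReal) * ((x / b n : ℝ) : EReal) := by
        rw [← EReal.coe_mul, mul_div_cancel₀ _ hn.ne']
    _ ≤ _ := by
        rw [one_div_one_div]
        exact mul_le_mul_of_nonneg_left h2 (by exact_mod_cast hn.le)

lemma limsup_log_measure_le (hb : ∀ᶠ n in atTop, 0 < b n)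
    (h : ∀ η > 0, ∀ᶠ n in atTop, P.real (A n) ≤ Real.exp ((c + η) / b n)) :
    limsup (fun n => ((1 / (1 / b n) : ℝ) : EReal) * ENNReal.log (P (A n))) atTop ≤ (c : EReal) := by
  refine EReal.le_of_forall_lt_iff_le.1 fun x hx => ?_
  have hx' : c < x := by exact_mod_cast hx
  refine limsup_le_of_le (by isBoundedDefault) ?_
  filter_upwards [hb, h (x - c) (by linarith)] with n hn hle
  have h1 : P (A n) ≤ ENNReal.ofReal (Real.exp (x / b n)) := by
    rw [← ofReal_measureReal]
    exact ENNReal.ofReal_le_ofReal (by simpa using hle)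
  have h2 : ENNReal.log (P (A n)) ≤ ((x / b n : ℝ) : EReal) := by
    have := ENNReal.log_monotone h1
    rwa [ENNReal.log_ofReal_of_pos (Real.exp_pos _), Real.log_exp] at this
  calc _ ≤ ((b n : ℝ) : EReal) * ((x / b n : ℝ) : EReal) := by
        rw [one_div_one_div]
        exact mul_le_mul_of_nonneg_left h2 (by exact_mod_cast hn.le)
    _ = x := by rw [← EReal.coe_mul, mul_div_cancel₀ _ hn.ne']

/-- A constant factor is negligible on the exponential scale `1 / b n`. -/
lemma eventually_const_le_exp_div (hb : ∀ᶠ n in atTop, 0 < b n) (hb0 : Tendsto b atTop (𝓝 0))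
    (K : ℝ) {ε : ℝ} (hε : 0 < ε) : ∀ᶠ n in atTop, K ≤ Real.exp (ε / b n) := by
  have h : Tendsto (fun n => ε / b n) atTop atTop :=
    Tendsto.const_mul_atTop hε
      (tendsto_inv_nhdsGT_zero.comp (tendsto_nhdsWithin_iff.2 ⟨hb0, hb⟩))
  exact (Real.tendsto_exp_atTop.comp h).eventually_ge_atTop K

end logarithms

/-! ### Gärtner–Ellis bounds for a quadratic limit. -/

section GartnerEllis

variable {Ω : Type*} [MeasurableSpace Ω] {P : Measure Ω} [IsProbabilityMeasure P]
  {b : ℕ → ℝ} {Z : ℕ → Ω → ℝ × ℝ} {L : ℝ × ℝ → ℝ}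

lemma eventually_integral_exp_le (hb : ∀ᶠ n in atTop, 0 < b n)
    (hint : ∀ l n, Integrable (fun ω => Real.exp (pairing l (Z n ω) / b n)) P)
    (hlim : ∀ l, Tendsto (fun n => b n * Real.log (∫ ω, Real.exp (pairing l (Z n ω) / b n) ∂P))
      atTop (𝓝 (L l))) (l : ℝ × ℝ) {ε : ℝ} (hε : 0 < ε) :
    ∀ᶠ n in atTop, Real.exp ((L l - ε) / b n) ≤ ∫ ω, Real.exp (pairing l (Z n ω) / b n) ∂P ∧
      ∫ ω, Real.exp (pairing l (Z n ω) / b n) ∂P ≤ Real.exp ((L l + ε) / b n) := by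
  filter_upwards [hb, (hlim l).eventually (Ioo_mem_nhds (sub_lt_self _ hε) (lt_add_of_pos_right _ hε))]
    with n hn h
  have hpos : 0 < ∫ ω, Real.exp (pairing l (Z n ω) / b n) ∂P := integral_exp_pos (hint l n)
  constructor
  · rw [← Real.le_log_iff_exp_le hpos, div_le_iff₀' hn]
    exact h.1.le
  · rw [← Real.log_le_iff_le_exp hpos, le_div_iff₀' hn]
    exact h.2.le

lemma measureReal_halfspace_le {n : ℕ} (hn : 0 < b n) (l : ℝ × ℝ) (c : ℝ)
    (hint : Integrable (fun ω => Real.exp (pairing l (Z n ω) / b n)) P) :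
    P.real {ω | c ≤ pairing l (Z n ω)} ≤
      Real.exp (-c / b n) * ∫ ω, Real.exp (pairing l (Z n ω) / b n) ∂P := by
  have h := measure_ge_le_exp_mul_mgf (μ := P) (X := fun ω => pairing l (Z n ω)) (t := (b n)⁻¹) c
    (inv_nonneg.2 hn.le) (by simpa only [div_eq_inv_mul] using hint)
  simpa only [mgf, div_eq_inv_mul, neg_mul, mul_neg] using h

lemma upper_bound_of_tendsto_log_mgf (hb : ∀ᶠ n in atTop, 0 < b n) (hb0 : Tendsto b atTop (𝓝 0))
    (hint : ∀ l n, Integrable (fun ω => Real.exp (pairing l (Z n ω) / b n)) P)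
    (hlim : ∀ l, Tendsto (fun n => b n * Real.log (∫ ω, Real.exp (pairing l (Z n ω) / b n) ∂P))
      atTop (𝓝 (L l))) {F : Set (ℝ × ℝ)} (hF : IsClosed F) :
    limsup (fun n : ℕ => ((1 / (1 / b n) : ℝ) : EReal) * ENNReal.log (P (Z n ⁻¹' F))) atTop ≤
      -(⨅ z ∈ F, legendre L z) := by
  rw [EReal.le_neg]
  refine EReal.ge_of_forall_gt_iff_ge.1 fun α hα => ?_
  rw [EReal.le_neg, ← EReal.coe_neg]
  obtain ⟨T, hT⟩ := exists_finset_halfspace_cover hF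
    fun z hz => hα.trans_le (iInf₂_le z hz)
  refine limsup_log_measure_le hb fun η hη => ?_
  have hev := (Finset.eventually_all T).2 fun l _ =>
    eventually_integral_exp_le hb hint hlim l (half_pos hη)
  -- Half of η pays for the error in the log-moment generating function, half for the number of
  -- half-spaces.
  filter_upwards [hb, hev, eventually_const_le_exp_div hb hb0 (T.card : ℝ) (half_pos hη)]
    with n hn hM hcard
  calc P.real (Z n ⁻¹' F)
      ≤ P.real (⋃ l ∈ T, {ω | L l + α ≤ pairing l (Z n ω)}) := by
        refine measureReal_mono (fun ω hω => ?_) (measure_ne_top _ _)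
        obtain ⟨l, hl, h⟩ := hT _ hω
        refine Set.mem_iUnion₂.2 ⟨l, hl, ?_⟩
        change L l + α ≤ pairing l (Z n ω)
        linarith
    _ ≤ ∑ l ∈ T, P.real {ω | L l + α ≤ pairing l (Z n ω)} := measureReal_biUnion_finset_le _ _
    _ ≤ ∑ l ∈ T, Real.exp ((-α + η / 2) / b n) := by
        refine Finset.sum_le_sum fun l hl => (measureReal_halfspace_le hn l _ (hint l n)).trans ?_
        refine (mul_le_mul_of_nonneg_left (hM l hl).2 (Real.exp_pos _).le).trans_eq ?_
        rw [← Real.exp_add]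
        congr 1
        ring
    _ = T.card * Real.exp ((-α + η / 2) / b n) := by rw [Finset.sum_const, nsmul_eq_mul]
    _ ≤ Real.exp (η / 2 / b n) * Real.exp ((-α + η / 2) / b n) :=
        mul_le_mul_of_nonneg_right hcard (Real.exp_pos _).le
    _ = Real.exp ((-α + η) / b n) := by
        rw [← Real.exp_add]
        congr 1
        ring

/-- Chernoff-type bound off a box, under the exponential tilt by `l`. -/
lemma exp_pairing_le_indicator_add {β δ t : ℝ} (hβ : 0 < β) (ht : 0 < t) (l z w : ℝ × ℝ) :
    Real.exp (pairing l w / β) ≤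
      Set.indicator {w : ℝ × ℝ | |w.1 - z.1| < δ ∧ |w.2 - z.2| < δ}
        (fun _ => Real.exp ((pairing l z + (|l.1| + |l.2|) * δ) / β)) w +
      ∑ θ ∈ ({(1, 0), (-1, 0), (0, 1), (0, -1)} : Finset (ℝ × ℝ)),
        Real.exp (-(t * (pairing θ z + δ)) / β) * Real.exp (pairing (l + t • θ) w / β) := by
  by_cases hw : |w.1 - z.1| < δ ∧ |w.2 - z.2| < δ
  · rw [Set.indicator_of_mem (by exact hw)]
    refine le_add_of_le_of_nonneg (Real.exp_le_exp.2 ?_)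
      (Finset.sum_nonneg fun θ _ => by positivity)
    gcongr
    have h1 : l.1 * (w.1 - z.1) ≤ |l.1| * δ :=
      (le_abs_self _).trans (by rw [abs_mul]; gcongr; exact hw.1.le)
    have h2 : l.2 * (w.2 - z.2) ≤ |l.2| * δ :=
      (le_abs_self _).trans (by rw [abs_mul]; gcongr; exact hw.2.le)
    simp only [pairing]
    linarith
  · rw [Set.indicator_of_notMem (by exact hw), zero_add]
    obtain ⟨θ, hθ, h⟩ : ∃ θ ∈ ({(1, 0), (-1, 0), (0, 1), (0, -1)} : Finset (ℝ × ℝ)),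
        pairing θ z + δ ≤ pairing θ w := by
      by_contra! hcon
      have h1 := hcon (1, 0) (by simp)
      have h2 := hcon (-1, 0) (by simp)
      have h3 := hcon (0, 1) (by simp)
      have h4 := hcon (0, -1) (by simp)
      simp only [pairing] at h1 h2 h3 h4
      exact hw ⟨abs_lt.2 ⟨by linarith, by linarith⟩, abs_lt.2 ⟨by linarith, by linarith⟩⟩
    -- In this half-space t (θ·w − θ·z − δ) ≥ 0, so the term of θ alone dominates.
    refine le_trans ?_ (Finset.single_le_sum (fun θ _ => by positivity) hθ)
    rw [← Real.exp_add, ← add_div]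
    refine Real.exp_le_exp.2 (div_le_div_of_nonneg_right ?_ hβ.le)
    have : pairing (l + t • θ) w = pairing l w + t * pairing θ w := by
      simp [pairing]; ring
    rw [this]
    nlinarith

/-- The gradient of the quadratic form of a symmetric matrix. -/
lemma quadForm_add_smul {p r s : ℝ} (l θ : ℝ × ℝ) (t : ℝ) :
    quadForm !![p, r; r, s] (l + t • θ) = quadForm !![p, r; r, s] l +
      t * pairing θ (p * l.1 + r * l.2, r * l.1 + s * l.2) + t ^ 2 * quadForm !![p, r; r, s] θ := by
  simp [quadForm, pairing, Matrix.mulVec, dotProduct, Fin.sum_univ_two]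
  ring

/-- A point of finite rate is orthogonal to the kernel, and for a symmetric matrix the orthogonal
complement of the kernel is the range. -/
lemma exists_eq_of_legendre_ne_top {p r s : ℝ} {z : ℝ × ℝ}
    (h : legendre (quadForm !![p, r; r, s]) z ≠ ⊤) :
    ∃ l : ℝ × ℝ, z = (p * l.1 + r * l.2, r * l.1 + s * l.2) := by
  -- The form vanishes along a kernel vector, so a nonzero pairing with z could be scaled up without
  -- cost.
  have hker : ∀ l : ℝ × ℝ, p * l.1 + r * l.2 = 0 → r * l.1 + s * l.2 = 0 → pairing l z = 0 := by
    intro l h1 h2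
    by_contra hne
    refine h (EReal.eq_top_iff_forall_lt _ |>.2 fun y => ?_)
    refine lt_of_lt_of_le ?_ (pairing_sub_le_legendre _ (((y + 1) / pairing l z) • l) z)
    have hq : quadForm !![p, r; r, s] (((y + 1) / pairing l z) • l) = 0 := by
      simp only [quadForm, Matrix.mulVec, dotProduct, Fin.sum_univ_two, Prod.smul_fst, smul_eq_mul,
        Prod.smul_snd, Matrix.cons_val_zero, Matrix.cons_val_one, Matrix.of_apply]
      linear_combination (1 / 2) * ((y + 1) / pairing l z) ^ 2 * (l.1 * h1 + l.2 * h2)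
    have hp : pairing (((y + 1) / pairing l z) • l) z = y + 1 := by
      have : ∀ k : ℝ, pairing (k • l) z = k * pairing l z := fun k => by
        simp [pairing]; ring
      rw [this, div_mul_cancel₀ _ hne]
    rw [hq, hp]
    exact_mod_cast (by linarith : y < y + 1 - 0)
  by_cases hdet : p * s - r ^ 2 = 0
  · have h1 := hker (r, -p) (by simp; ring) (by simp; linarith)
    have h2 := hker (s, -r) (by simp; linarith) (by simp; ring)
    simp only [pairing] at h1 h2
    by_cases hτ : p + s = 0
    · have hs : s = -p := by linarith
      subst hs
      have hp : p = 0 := by nlinarith [sq_nonneg p, sq_nonneg r]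
      have hr : r = 0 := by nlinarith [sq_nonneg p, sq_nonneg r]
      -- The matrix is zero here, so z lies in the kernel and is orthogonal to itself.
      have h3 := hker z (by simp [hp, hr]) (by simp [hp, hr])
      simp only [pairing] at h3
      refine ⟨0, Prod.ext ?_ ?_⟩ <;> simp <;> nlinarith [sq_nonneg z.1, sq_nonneg z.2]
    -- Orthogonality to (r, −p) and (s, −r) says exactly that z is an eigenvector with eigenvalue
    -- the trace.
    · refine ⟨(z.1 / (p + s), z.2 / (p + s)), Prod.ext ?_ ?_⟩ <;> field_simp <;> linarith
  · have hinv := mul_inv_cancel₀ hdet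
    refine ⟨((s * z.1 - r * z.2) / (p * s - r ^ 2), (p * z.2 - r * z.1) / (p * s - r ^ 2)),
      Prod.ext ?_ ?_⟩
    · linear_combination (-z.1) * hinv
    · linear_combination (-z.2) * hinv

/-- The box is centred at the gradient of Q at l. Off it, a further tilt by tθ costs t² Q θ but
gains tδ, because the linear term of Q(l + tθ) cancels against t θ·z. Small t thus makes the
complement negligible in the integral, and the box must carry at least half of it. -/
lemma eventually_exp_le_measureReal_box {p r s : ℝ} (hZ : ∀ n, Measurable (Z n))
    (hb : ∀ᶠ n in atTop, 0 < b n) (hb0 : Tendsto b atTop (𝓝 0))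
    (hint : ∀ l n, Integrable (fun ω => Real.exp (pairing l (Z n ω) / b n)) P)
    (hlim : ∀ l, Tendsto (fun n => b n * Real.log (∫ ω, Real.exp (pairing l (Z n ω) / b n) ∂P))
      atTop (𝓝 (quadForm !![p, r; r, s] l))) (l : ℝ × ℝ) {δ ε : ℝ} (hδ : 0 < δ) (hε : 0 < ε) :
    ∀ᶠ n in atTop, Real.exp ((quadForm !![p, r; r, s] l -
        pairing l (p * l.1 + r * l.2, r * l.1 + s * l.2) - (|l.1| + |l.2|) * δ - ε) / b n) ≤
      P.real (Z n ⁻¹' {w : ℝ × ℝ | |w.1 - (p * l.1 + r * l.2)| < δ ∧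
        |w.2 - (r * l.1 + s * l.2)| < δ}) := by
  set Q := quadForm !![p, r; r, s] with hQ
  set z : ℝ × ℝ := (p * l.1 + r * l.2, r * l.1 + s * l.2) with hz
  set T : Finset (ℝ × ℝ) := {(1, 0), (-1, 0), (0, 1), (0, -1)} with hT
  set B : Set (ℝ × ℝ) := {w | |w.1 - z.1| < δ ∧ |w.2 - z.2| < δ} with hB
  have hBm : MeasurableSet B := by
    apply IsOpen.measurableSet
    exact (isOpen_lt (f := fun w : ℝ × ℝ => |w.1 - z.1|) (by fun_prop) continuous_const).inter
      (isOpen_lt (f := fun w : ℝ × ℝ => |w.2 - z.2|) (by fun_prop) continuous_const)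
  -- With this t the quadratic cost uses at most half of the gain tδ.
  obtain ⟨t, ht, htQ⟩ : ∃ t : ℝ, 0 < t ∧ ∀ θ ∈ T, t * Q θ ≤ δ / 2 := by
    have hD : 0 < 2 * (1 + ∑ θ ∈ T, |Q θ|) := by
      have := Finset.sum_nonneg (fun θ (_ : θ ∈ T) => abs_nonneg (Q θ))
      positivity
    refine ⟨δ / (2 * (1 + ∑ θ ∈ T, |Q θ|)), by positivity, fun θ hθ => ?_⟩
    have h1 : Q θ ≤ 1 + ∑ θ ∈ T, |Q θ| :=
      (le_abs_self _).trans ((Finset.single_le_sum (fun θ _ => abs_nonneg (Q θ)) hθ).trans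
        (by linarith))
    calc _ ≤ δ / (2 * (1 + ∑ θ ∈ T, |Q θ|)) * (1 + ∑ θ ∈ T, |Q θ|) := by gcongr
      _ = δ / 2 := by field_simp
  -- κ is the error allowed in the log-moment generating functions. The bound 2κ ≤ tδ/4 leaves a
  -- surplus tδ/4 to absorb `2 * T.card`; κ ≤ ε/2 leaves ε/2 to absorb the factor 2.
  set κ := min (ε / 2) (t * δ / 8) with hκ
  have hκ0 : 0 < κ := by positivity
  have hκε : κ ≤ ε / 2 := min_le_left _ _
  have hκt : κ ≤ t * δ / 8 := min_le_right _ _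
  have hev := (Finset.eventually_all T).2 fun θ _ =>
    eventually_integral_exp_le hb hint hlim (l + t • θ) hκ0
  filter_upwards [hb, hev, eventually_integral_exp_le hb hint hlim l hκ0,
    eventually_const_le_exp_div hb hb0 (2 * T.card : ℝ) (by positivity : 0 < t * δ / 4),
    eventually_const_le_exp_div hb hb0 2 (half_pos hε)] with n hn hM hM0 hcard htwo
  have key : ∫ ω, Real.exp (pairing l (Z n ω) / b n) ∂P ≤
      P.real (Z n ⁻¹' B) * Real.exp ((pairing l z + (|l.1| + |l.2|) * δ) / b n) +
      ∑ θ ∈ T, Real.exp (-(t * (pairing θ z + δ)) / b n) *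
        ∫ ω, Real.exp (pairing (l + t • θ) (Z n ω) / b n) ∂P := by
    have hi1 : Integrable (fun ω => Set.indicator B
        (fun _ => Real.exp ((pairing l z + (|l.1| + |l.2|) * δ) / b n)) (Z n ω)) P :=
      (integrable_const (Real.exp ((pairing l z + (|l.1| + |l.2|) * δ) / b n))).indicator
        (hZ n hBm)
    have hi2 : ∀ θ ∈ T, Integrable (fun ω => Real.exp (-(t * (pairing θ z + δ)) / b n) *
        Real.exp (pairing (l + t • θ) (Z n ω) / b n)) P := fun θ _ => (hint _ n).const_mul _
    refine (integral_mono (hint l n) (hi1.add (integrable_finsetSum _ hi2))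
      fun ω => exp_pairing_le_indicator_add hn ht l z (Z n ω)).trans_eq ?_
    simp only [Pi.add_apply]
    rw [integral_add hi1 (integrable_finsetSum _ hi2), integral_finsetSum _ hi2]
    congr 1
    · have := integral_indicator_const (μ := P)
        (Real.exp ((pairing l z + (|l.1| + |l.2|) * δ) / b n)) (hZ n hBm)
      rw [smul_eq_mul] at this
      exact this
    · exact Finset.sum_congr rfl fun θ _ => integral_const_mul _ _
  have hsum : ∑ θ ∈ T, Real.exp (-(t * (pairing θ z + δ)) / b n) *
      ∫ ω, Real.exp (pairing (l + t • θ) (Z n ω) / b n) ∂P ≤ 1 / 2 * Real.exp ((Q l - κ) / b n) := by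
    calc _ ≤ ∑ θ ∈ T, Real.exp ((Q l - κ - t * δ / 4) / b n) := by
          refine Finset.sum_le_sum fun θ hθ =>
            (mul_le_mul_of_nonneg_left (hM θ hθ).2 (Real.exp_pos _).le).trans ?_
          rw [← Real.exp_add, ← add_div]
          refine Real.exp_le_exp.2 (div_le_div_of_nonneg_right ?_ hn.le)
          have h1 := quadForm_add_smul (p := p) (r := r) (s := s) l θ t
          have h2 := mul_le_mul_of_nonneg_left (htQ θ hθ) ht.le
          rw [← hQ, ← hz] at h1
          rw [h1]
          nlinarith
      _ = T.card * Real.exp ((Q l - κ - t * δ / 4) / b n) := by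
          rw [Finset.sum_const, nsmul_eq_mul]
      _ ≤ 1 / 2 * Real.exp (t * δ / 4 / b n) * Real.exp ((Q l - κ - t * δ / 4) / b n) :=
          mul_le_mul_of_nonneg_right (by linarith) (Real.exp_pos _).le
      _ = _ := by
          rw [mul_assoc, ← Real.exp_add, ← add_div]
          congr 3
          ring
  have hmain : 1 / 2 * Real.exp ((Q l - κ) / b n) ≤
      P.real (Z n ⁻¹' B) * Real.exp ((pairing l z + (|l.1| + |l.2|) * δ) / b n) := by
    linarith [hM0.1]
  refine le_of_mul_le_mul_right (le_trans ?_ hmain)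
    (Real.exp_pos ((pairing l z + (|l.1| + |l.2|) * δ) / b n))
  rw [← Real.exp_add, ← add_div]
  have h3 : 2 * Real.exp ((Q l - ε) / b n) ≤ Real.exp ((Q l - κ) / b n) := by
    calc _ ≤ Real.exp (ε / 2 / b n) * Real.exp ((Q l - ε) / b n) :=
          mul_le_mul_of_nonneg_right htwo (Real.exp_pos _).le
      _ = Real.exp ((Q l - ε / 2) / b n) := by
          rw [← Real.exp_add, ← add_div]
          congr 2
          ring
      _ ≤ _ := by gcongr
  have h4 : Q l - pairing l z - (|l.1| + |l.2|) * δ - ε + (pairing l z + (|l.1| + |l.2|) * δ) =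
      Q l - ε := by ring
  rw [h4]
  linarith

lemma lower_bound_of_tendsto_log_mgf {p r s : ℝ} (hZ : ∀ n, Measurable (Z n))
    (hb : ∀ᶠ n in atTop, 0 < b n) (hb0 : Tendsto b atTop (𝓝 0))
    (hint : ∀ l n, Integrable (fun ω => Real.exp (pairing l (Z n ω) / b n)) P)
    (hlim : ∀ l, Tendsto (fun n => b n * Real.log (∫ ω, Real.exp (pairing l (Z n ω) / b n) ∂P))
      atTop (𝓝 (quadForm !![p, r; r, s] l))) {O : Set (ℝ × ℝ)} (hO : IsOpen O) :
    -(⨅ z ∈ O, legendre (quadForm !![p, r; r, s]) z) ≤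
      liminf (fun n : ℕ => ((1 / (1 / b n) : ℝ) : EReal) * ENNReal.log (P (Z n ⁻¹' O))) atTop := by
  rw [EReal.neg_le]
  refine le_iInf₂ fun z hz => ?_
  rw [EReal.neg_le]
  by_cases htop : legendre (quadForm !![p, r; r, s]) z = ⊤
  · rw [htop]; simp
  obtain ⟨l, hl⟩ := exists_eq_of_legendre_ne_top htop
  -- Only the trivial inequality between the rate and its value at l is needed, not that l attains
  -- the supremum.
  refine (EReal.neg_le_neg_iff.2 (pairing_sub_le_legendre _ l z)).trans ?_
  rw [← EReal.coe_neg]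
  refine le_liminf_log_measure hb fun η hη => ?_
  obtain ⟨ρ, hρ, hball⟩ := Metric.isOpen_iff.1 hO z hz
  -- D makes the oscillation (|l.1| + |l.2|)δ of the tilt over the box at most η/2; the added 1
  -- keeps D positive.
  set D := 2 * (|l.1| + |l.2| + 1) with hD
  have hD0 : 0 < D := by positivity
  have hδ : 0 < min ρ (η / D) := by positivity
  filter_upwards [hb, eventually_exp_le_measureReal_box hZ hb hb0 hint hlim l hδ (half_pos hη)]
    with n hn h
  rw [← hl] at h
  refine le_trans (Real.exp_le_exp.2 (div_le_div_of_nonneg_right ?_ hn.le))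
    (h.trans (measureReal_mono ?_))
  · have h1 : (|l.1| + |l.2|) * min ρ (η / D) ≤ η / 2 := by
      calc _ ≤ (|l.1| + |l.2| + 1) * (η / D) :=
            mul_le_mul (by linarith) (min_le_right _ _) hδ.le (by positivity)
        _ = η / 2 := by rw [hD]; field_simp
    linarith
  · intro ω hω
    apply hball
    rw [Metric.mem_ball, Prod.dist_eq, max_lt_iff, Real.dist_eq, Real.dist_eq]
    rw [hl]
    exact ⟨hω.1.trans_le (min_le_left _ _), hω.2.trans_le (min_le_left _ _)⟩

/-- The Gärtner–Ellis theorem in `ℝ²` with a quadratic (possibly degenerate) limit. -/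
theorem satisfiesLDP_of_tendsto_log_mgf {p r s : ℝ} (hZ : ∀ n, Measurable (Z n))
    (hb : ∀ n, 1 ≤ n → 0 < b n) (hb0 : Tendsto b atTop (𝓝 0))
    (hint : ∀ l n, Integrable (fun ω => Real.exp (pairing l (Z n ω) / b n)) P)
    (hlim : ∀ l, Tendsto (fun n => b n * Real.log (∫ ω, Real.exp (pairing l (Z n ω) / b n) ∂P))
      atTop (𝓝 (quadForm !![p, r; r, s] l))) :
    SatisfiesLDP P Z (fun n => 1 / b n) (legendre (quadForm !![p, r; r, s])) ∧
      IsGoodRateFunction (legendre (quadForm !![p, r; r, s])) := by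
  have hbe : ∀ᶠ n in atTop, 0 < b n := eventually_atTop.2 ⟨1, hb⟩
  have hgood : IsGoodRateFunction (legendre (quadForm !![p, r; r, s])) :=
    isGoodRateFunction_legendre (by simp [quadForm, dotProduct, Matrix.mulVec, Fin.sum_univ_two])
  refine ⟨⟨⟨fun n hn => one_div_pos.2 (hb n hn), ?_⟩, hgood.toIsRateFunction,
    fun O hO => lower_bound_of_tendsto_log_mgf hZ hbe hb0 hint hlim hO,
    fun F hF => upper_bound_of_tendsto_log_mgf hbe hb0 hint hlim hF⟩, hgood⟩
  simpa only [one_div, Function.comp_def] using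
    tendsto_inv_nhdsGT_zero.comp (tendsto_nhdsWithin_iff.2 ⟨hb0, hbe⟩)

end GartnerEllis

end

/-! ### Geometry of the hexagonal lattice. -/

noncomputable section

lemma cos_two_thirds_pi : Real.cos (2 / 3 * Real.pi) = -(1 / 2) := by
  rw [show 2 / 3 * Real.pi = Real.pi - Real.pi / 3 by ring, Real.cos_pi_sub, Real.cos_pi_div_three]

lemma sin_two_thirds_pi : Real.sin (2 / 3 * Real.pi) = √3 / 2 := by
  rw [show 2 / 3 * Real.pi = Real.pi - Real.pi / 3 by ring, Real.sin_pi_sub, Real.sin_pi_div_three]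

lemma cos_two_mul_two_thirds_pi : Real.cos (2 * (2 / 3 * Real.pi)) = -(1 / 2) := by
  rw [Real.cos_two_mul, cos_two_thirds_pi]; norm_num

lemma sin_two_mul_two_thirds_pi : Real.sin (2 * (2 / 3 * Real.pi)) = -(√3 / 2) := by
  rw [Real.sin_two_mul, cos_two_thirds_pi, sin_two_thirds_pi]; ring

lemma hexStep_zero (a : ℝ) : hexStep a 0 =
    ![(a, 0), (-(a / 2), a * (√3 / 2)), (-(a / 2), -(a * (√3 / 2)))] := by
  funext r
  fin_cases r <;>
    simp [hexStep, cos_two_thirds_pi, sin_two_thirds_pi, cos_two_mul_two_thirds_pi,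
      sin_two_mul_two_thirds_pi] <;> ring

lemma hexStep_one (a : ℝ) (r : Fin 3) : hexStep a 1 r = -hexStep a 0 r := by
  simp [hexStep]

/-- This makes the step numbers recoverable from the positions, so that different step sequences
give disjoint events. -/
lemma hexStep_injective {a : ℝ} (ha : 0 < a) (i : Fin 2) : Function.Injective (hexStep a i) := by
  have h0 : Function.Injective (hexStep a 0) := by
    have h3 : 0 < a * (√3 / 2) := by positivity
    rw [hexStep_zero]
    intro r s h
    fin_cases r <;> fin_cases s <;> simp [Prod.ext_iff] at h ⊢ <;> linarith
  fin_cases i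
  · exact h0
  · intro r s h
    change hexStep a 1 r = hexStep a 1 s at h
    rw [hexStep_one, hexStep_one] at h
    exact h0 (neg_injective h)

lemma add_hexStep_mem_vertexSet {a : ℝ} {i : Fin 2} {p : ℝ × ℝ} (hp : p ∈ vertexSet a i)
    (r : Fin 3) : p + hexStep a i r ∈ vertexSet a (i + 1) := by
  obtain ⟨j, k, rfl⟩ := hp
  fin_cases i
  · change _ + hexStep a 0 r ∈ vertexSet a 1
    rw [hexStep_zero]
    fin_cases r
    · exact ⟨j, k, by simp⟩
    -- −a/2 = −3a/2 + a forces j − 1, and the shift of k then corrects the second coordinate.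
    · refine ⟨j - 1, k + 1, ?_⟩
      ext <;> simp <;> ring
    · refine ⟨j - 1, k, ?_⟩
      ext <;> simp <;> ring
  · change _ + hexStep a 1 r ∈ vertexSet a 0
    rw [hexStep_one, hexStep_zero]
    fin_cases r
    · exact ⟨j, k, by simp⟩
    · refine ⟨j + 1, k - 1, ?_⟩
      ext <;> simp <;> ring
    · refine ⟨j + 1, k, ?_⟩
      ext <;> simp <;> ring

/-! ### Lattice paths and expectations over them. -/

/-- The class of the vertices visited at time `n`. -/
def parity (n : ℕ) : Fin 2 := Fin.ofNat 2 n

lemma parity_succ (n : ℕ) : parity (n + 1) = parity n + 1 := by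
  ext
  simp [parity, Fin.val_add]

/-- The lattice path from the origin with successive step numbers `r 0, r 1, …`. -/
def hexPath (a : ℝ) (r : ℕ → Fin 3) : ℕ → ℝ × ℝ
  | 0 => 0
  | n + 1 => hexPath a r n + hexStep a (parity n) (r n)

lemma hexPath_mem_vertexSet (a : ℝ) (r : ℕ → Fin 3) (n : ℕ) :
    hexPath a r n ∈ vertexSet a (parity n) := by
  induction n with
  | zero => exact ⟨0, 0, by simp [hexPath, parity]; rfl⟩
  | succ n ih =>
    rw [parity_succ]
    exact add_hexStep_mem_vertexSet ih (r n)

/-- Extension of finitely many step numbers by `0`. -/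
def extendSteps {n : ℕ} (r : Fin n → Fin 3) (k : ℕ) : Fin 3 := if h : k < n then r ⟨k, h⟩ else 0

lemma extendSteps_coe {n : ℕ} (r : Fin n → Fin 3) (k : Fin n) : extendSteps r k = r k := by
  simp [extendSteps]

/-- Makes the filler value in `extendSteps` irrelevant. -/
lemma hexPath_congr {a : ℝ} {r r' : ℕ → Fin 3} {n : ℕ} (h : ∀ k < n, r k = r' k) :
    hexPath a r n = hexPath a r' n := by
  induction n with
  | zero => rfl
  | succ n ih => rw [hexPath, hexPath, ih fun k hk => h k (by omega), h n (by omega)]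

/-- The expectation of `f` at the position of the walk after `n` steps, by recursion on the last
step. -/
def walkExpect (a : ℝ) (q : Fin 2 → Fin 3 → ℝ) : ℕ → (ℝ × ℝ → ℝ) → ℝ
  | 0, f => f 0
  | n + 1, f => walkExpect a q n fun z => ∑ r, q (parity n) r * f (z + hexStep a (parity n) r)

/-- The recursive form suits the mean and the moment generating function; the sum over paths gives
linearity and the link with the law of the walk. -/
lemma walkExpect_eq_sum (a : ℝ) (q : Fin 2 → Fin 3 → ℝ) (n : ℕ) (f : ℝ × ℝ → ℝ) :
    walkExpect a q n f = ∑ r : Fin n → Fin 3, (∏ k : Fin n, q (parity k) (r k)) *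
      f (hexPath a (extendSteps r) n) := by
  induction n generalizing f with
  | zero => simp [walkExpect, hexPath]
  | succ n ih =>
    rw [walkExpect, ih, ← (Fin.snocEquiv fun _ => Fin 3).sum_comp, Fintype.sum_prod_type_right]
    refine Finset.sum_congr rfl fun r _ => ?_
    rw [Finset.mul_sum]
    refine Finset.sum_congr rfl fun j _ => ?_
    have hl : extendSteps (Fin.snoc r j : Fin (n + 1) → Fin 3) n = j := by
      simpa using extendSteps_coe (Fin.snoc r j : Fin (n + 1) → Fin 3) (Fin.last n)
    have hp : hexPath a (extendSteps (Fin.snoc r j : Fin (n + 1) → Fin 3)) n =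
        hexPath a (extendSteps r) n := by
      refine hexPath_congr fun k hk => ?_
      have h1 := extendSteps_coe (Fin.snoc r j : Fin (n + 1) → Fin 3) (Fin.castSucc ⟨k, hk⟩)
      have h2 := extendSteps_coe r ⟨k, hk⟩
      rw [Fin.snoc_castSucc] at h1
      exact h1.trans h2.symm
    simp only [Fin.snocEquiv, Equiv.coe_fn_mk]
    rw [Fin.prod_univ_castSucc, hexPath, hl, hp]
    simp [mul_assoc]

lemma walkExpect_one (a : ℝ) {q : Fin 2 → Fin 3 → ℝ} (hq : ∀ i, ∑ r, q i r = 1) (n : ℕ) :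
    walkExpect a q n (fun _ => 1) = 1 := by
  induction n with
  | zero => rfl
  | succ n ih => simpa [walkExpect, hq] using ih

lemma walkExpect_mul_const (a : ℝ) (q : Fin 2 → Fin 3 → ℝ) (n : ℕ) (f : ℝ × ℝ → ℝ) (c : ℝ) :
    walkExpect a q n (fun z => f z * c) = walkExpect a q n f * c := by
  simp only [walkExpect_eq_sum, Finset.sum_mul, mul_assoc]

lemma walkExpect_add (a : ℝ) (q : Fin 2 → Fin 3 → ℝ) (n : ℕ) (f g : ℝ × ℝ → ℝ) :
    walkExpect a q n (fun z => f z + g z) = walkExpect a q n f + walkExpect a q n g := by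
  simp only [walkExpect_eq_sum, mul_add, Finset.sum_add_distrib]

/-- The mean of a linear functional of the walk. -/
lemma walkExpect_pairing (a : ℝ) {q : Fin 2 → Fin 3 → ℝ} (hq : ∀ i, ∑ r, q i r = 1) (n : ℕ)
    (l : ℝ × ℝ) : walkExpect a q n (pairing l) =
      ∑ k ∈ Finset.range n, ∑ r, q (parity k) r * pairing l (hexStep a (parity k) r) := by
  induction n with
  | zero => simp [walkExpect, pairing]
  | succ n ih =>
    -- The factor 1 is the constant function to which `walkExpect_mul_const` and `walkExpect_one`
    -- apply.
    have h : ∀ z, ∑ r, q (parity n) r * pairing l (z + hexStep a (parity n) r) =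
        pairing l z + 1 * ∑ r, q (parity n) r * pairing l (hexStep a (parity n) r) := by
      intro z
      have : ∀ w, pairing l (z + w) = pairing l z + pairing l w := fun w => by
        simp [pairing]; ring
      simp only [this, mul_add, Finset.sum_add_distrib, ← Finset.sum_mul, hq]
      ring
    rw [walkExpect, Finset.sum_range_succ]
    simp only [h]
    rw [walkExpect_add, ih, walkExpect_mul_const, walkExpect_one a hq, one_mul]

/-- The moment generating function of the walk. -/
lemma walkExpect_exp_pairing (a : ℝ) (q : Fin 2 → Fin 3 → ℝ) (n : ℕ) (l : ℝ × ℝ) (s : ℝ) :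
    walkExpect a q n (fun z => Real.exp (s * pairing l z)) =
      ∏ k ∈ Finset.range n, ∑ r, q (parity k) r * Real.exp (s * pairing l (hexStep a (parity k) r)) := by
  induction n with
  | zero => simp [walkExpect, pairing]
  | succ n ih =>
    have h : ∀ z, ∑ r, q (parity n) r * Real.exp (s * pairing l (z + hexStep a (parity n) r)) =
        Real.exp (s * pairing l z) *
          ∑ r, q (parity n) r * Real.exp (s * pairing l (hexStep a (parity n) r)) := by
      intro z
      rw [Finset.mul_sum]
      refine Finset.sum_congr rfl fun r _ => ?_
      have : pairing l (z + hexStep a (parity n) r) = pairing l z + pairing l (hexStep a (parity n) r) := by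
        simp [pairing]; ring
      rw [this, mul_add, Real.exp_add]
      ring
    rw [walkExpect, Finset.prod_range_succ]
    simp only [h]
    rw [walkExpect_mul_const, ih]

/-! ### Law of the walk. -/

section law

variable {Ω : Type*} [MeasurableSpace Ω] {P : Measure Ω}
  {a : ℝ} {q : Fin 2 → Fin 3 → ℝ} {X Y : ℕ → Ω → ℝ}

lemma measurableSet_position_eq (h : IsHexWalk P a q X Y) (k : ℕ) (z : ℝ × ℝ) :
    MeasurableSet {ω | (X k ω, Y k ω) = z} :=
  ((h.measurable_fst k).prodMk (h.measurable_snd k)) (measurableSet_singleton z)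

lemma measurableSet_history (h : IsHexWalk P a q X Y) (n : ℕ) (s : ℕ → ℝ × ℝ) :
    MeasurableSet {ω | ∀ k ≤ n, (X k ω, Y k ω) = s k} := by
  have : {ω | ∀ k ≤ n, (X k ω, Y k ω) = s k} = ⋂ k ≤ n, {ω | (X k ω, Y k ω) = s k} := by
    ext; simp
  rw [this]
  exact MeasurableSet.iInter fun k => MeasurableSet.iInter fun _ =>
    measurableSet_position_eq h k _

/-- The transition rule multiplies in one factor per step. It says nothing after a null history, but
then both sides vanish. -/
lemma measureReal_history [IsProbabilityMeasure P] (hq : ∀ i r, 0 ≤ q i r) (h : IsHexWalk P a q X Y) (r : ℕ → Fin 3)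
    (n : ℕ) : P.real {ω | ∀ k ≤ n, (X k ω, Y k ω) = hexPath a r k} =
      ∏ k ∈ Finset.range n, q (parity k) (r k) := by
  induction n with
  | zero =>
    have h0 : {ω | ∀ k ≤ 0, (X k ω, Y k ω) = hexPath a r k} = {ω | (X 0 ω, Y 0 ω) = (0, 0)} := by
      ext ω; simp [hexPath]
    rw [h0, measureReal_def, h.initial]
    simp
  | succ n ih =>
    have hsplit : {ω | ∀ k ≤ n + 1, (X k ω, Y k ω) = hexPath a r k} =
        {ω | ∀ k ≤ n, (X k ω, Y k ω) = hexPath a r k} ∩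
          {ω | (X (n + 1) ω, Y (n + 1) ω) = hexPath a r n + hexStep a (parity n) (r n)} := by
      ext ω
      constructor
      · exact fun H => ⟨fun k hk => H k (by omega), H (n + 1) le_rfl⟩
      · rintro ⟨H1, H2⟩ k hk
        rcases Nat.le_succ_iff.1 hk with hk | rfl
        · exact H1 k hk
        · exact H2
    rw [Finset.prod_range_succ, ← ih, hsplit]
    by_cases h0 : P {ω | ∀ k ≤ n, (X k ω, Y k ω) = hexPath a r k} = 0
    · rw [measureReal_def, measureReal_def, h0, measure_mono_null Set.inter_subset_left h0]
      simp
    · have ht := h.transition n (hexPath a r) (parity n) (r n) (hexPath_mem_vertexSet a r n) h0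
      rw [measureReal_def, ← cond_mul_eq_inter (measurableSet_history h n _), ht, ENNReal.toReal_mul,
        ENNReal.toReal_ofReal (hq _ _), measureReal_def, mul_comm]

/-- Almost surely the walk follows one of finitely many lattice paths, so any function of its
position is almost everywhere a simple function. -/
lemma integrable_and_integral_eq_walkExpect [IsProbabilityMeasure P] (ha : 0 < a)
    (hq : ∀ i r, 0 ≤ q i r) (hq1 : ∀ i, ∑ r, q i r = 1) (h : IsHexWalk P a q X Y) (n : ℕ) (f : ℝ × ℝ → ℝ) :
    Integrable (fun ω => f (X n ω, Y n ω)) P ∧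
      ∫ ω, f (X n ω, Y n ω) ∂P = walkExpect a q n f := by
  classical
  set A : (Fin n → Fin 3) → Set Ω :=
    fun r => {ω | ∀ k ≤ n, (X k ω, Y k ω) = hexPath a (extendSteps r) k} with hA
  have hAm : ∀ r, MeasurableSet (A r) := fun r => measurableSet_history h n _
  have hAP : ∀ r, P.real (A r) = ∏ k : Fin n, q (parity k) (r k) := by
    intro r
    rw [hA, measureReal_history hq h, Finset.prod_range]
    simp only [extendSteps_coe]
  have hdisj : Pairwise (Function.onFun Disjoint A) := by
    intro r r' hne
    refine Set.disjoint_left.2 fun ω hω hω' => hne (funext fun k => ?_)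
    have h1 := (hω (k + 1) k.2).symm.trans (hω' (k + 1) k.2)
    have h2 := (hω k k.2.le).symm.trans (hω' k k.2.le)
    rw [hexPath, hexPath, h2] at h1
    have h3 := hexStep_injective ha _ (add_left_cancel h1)
    rwa [extendSteps_coe, extendSteps_coe] at h3
  -- The path events are disjoint and their probabilities already sum to 1, so no other trajectory
  -- has mass.
  have htotal : P.real (⋃ r, A r) = 1 := by
    rw [measureReal_iUnion_fintype hdisj hAm]
    simp only [hAP]
    simpa [walkExpect_eq_sum] using walkExpect_one a hq1 n
  have hae : ∀ᵐ ω ∂P, ω ∈ ⋃ r, A r := by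
    refine (mem_ae_iff_prob_eq_one (MeasurableSet.iUnion hAm)).2 ?_
    rw [← ofReal_measureReal, htotal, ENNReal.ofReal_one]
  have heq : (fun ω => f (X n ω, Y n ω)) =ᵐ[P] fun ω => ∑ r, (A r).indicator
      (fun _ => f (hexPath a (extendSteps r) n)) ω := by
    filter_upwards [hae] with ω hω
    obtain ⟨r, hr⟩ := Set.mem_iUnion.1 hω
    rw [Finset.sum_eq_single r, Set.indicator_of_mem hr, hr n le_rfl]
    · intro r' _ hne
      exact Set.indicator_of_notMem (fun hr' => Set.disjoint_left.1 (hdisj hne) hr' hr) _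
    · simp
  have hint : ∀ r ∈ Finset.univ, Integrable ((A r).indicator
      (fun _ => f (hexPath a (extendSteps r) n))) P :=
    fun r _ => (integrable_const _).indicator (hAm r)
  refine ⟨(integrable_finsetSum _ hint).congr heq.symm, ?_⟩
  rw [integral_congr_ae heq, integral_finsetSum _ hint, walkExpect_eq_sum]
  refine Finset.sum_congr rfl fun r _ => ?_
  rw [integral_indicator_const _ (hAm r), hAP, smul_eq_mul]

end law

end

/-! ### Asymptotics of the logarithmic moment generating function. -/

noncomputable section

open Asymptotics in
/-- Second-order expansion of the logarithmic moment generating function of a centred finitely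
supported distribution. -/
lemma tendsto_log_sum_exp_div_sq {ι : Type*} [Fintype ι] {q c : ι → ℝ} (hq : ∑ r, q r = 1)
    (hc : ∑ r, q r * c r = 0) :
    Tendsto (fun s => Real.log (∑ r, q r * Real.exp (s * c r)) / s ^ 2) (𝓝[≠] 0)
      (𝓝 (1 / 2 * ∑ r, q r * c r ^ 2)) := by
  set G : ℝ → ℝ := fun s => ∑ r, q r * Real.exp (s * c r) with hG
  set V := 1 / 2 * ∑ r, q r * c r ^ 2 with hV
  have hexp : (fun x : ℝ => Real.exp x - 1 - x - x ^ 2 / 2) =o[𝓝 0] fun x => x ^ 2 := by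
    have := Real.exp_sub_sum_range_succ_isLittleO_pow 2
    simp only [Finset.sum_range_succ, Finset.sum_range_zero] at this
    refine this.congr_left fun x => ?_
    simp
    ring
  -- Centring removes the linear term: G s = 1 + V s² + o(s²).
  have hu : (fun s => G s - 1 - V * s ^ 2) =o[𝓝 0] fun s => s ^ 2 := by
    have hr : ∀ r ∈ Finset.univ, (fun s => q r * (Real.exp (s * c r) - 1 - s * c r -
        (s * c r) ^ 2 / 2)) =o[𝓝 0] fun s : ℝ => s ^ 2 := by
      intro r _
      have ht : Tendsto (fun s : ℝ => s * c r) (𝓝 0) (𝓝 0) := by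
        simpa using (tendsto_id (α := ℝ) (x := 𝓝 0)).mul_const (c r)
      refine ((hexp.comp_tendsto ht).trans_isBigO ?_).const_mul_left _
      refine IsBigO.of_bound (c r ^ 2) (Eventually.of_forall fun s => le_of_eq ?_)
      simp [mul_pow, mul_comm]
    refine (IsLittleO.sum hr).congr_left fun s => ?_
    have h1 : ∀ r, q r * (Real.exp (s * c r) - 1 - s * c r - (s * c r) ^ 2 / 2) =
        q r * Real.exp (s * c r) - q r - s * (q r * c r) - s ^ 2 / 2 * (q r * c r ^ 2) :=
      fun r => by ring
    rw [Finset.sum_apply]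
    simp only [h1, Finset.sum_sub_distrib, ← Finset.mul_sum, hq, hc, hG, hV]
    ring
  have hO : (fun s => G s - 1) =O[𝓝 0] fun s => s ^ 2 := by
    have := hu.isBigO.add (isBigO_const_mul_self V (fun s : ℝ => s ^ 2) (𝓝 0))
    simpa using this
  have hG1 : Tendsto G (𝓝 0) (𝓝 1) := by
    have hcont : Continuous G := by fun_prop
    have := hcont.tendsto 0
    simpa [hG, hq] using this
  -- log G = (G − 1) + o(G − 1), and G − 1 = O(s²).
  have hlog : (fun s => Real.log (G s) - (G s - 1)) =o[𝓝 0] fun s => s ^ 2 := by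
    have hd := (Real.hasDerivAt_log one_ne_zero).isLittleO
    refine IsLittleO.trans_isBigO ?_ hO
    refine (hd.comp_tendsto hG1).congr_left fun s => ?_
    simp
  have hfin : Tendsto (fun s => (Real.log (G s) - V * s ^ 2) / s ^ 2) (𝓝[≠] 0) (𝓝 0) := by
    have := (hlog.add hu).tendsto_div_nhds_zero.mono_left (nhdsWithin_le_nhds (s := {0}ᶜ))
    refine this.congr fun s => ?_
    ring
  have := hfin.add_const V
  rw [zero_add] at this
  refine this.congr' ?_
  filter_upwards [self_mem_nhdsWithin] with s hs
  have hs' : s ≠ 0 := hs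
  field_simp
  ring

lemma sum_range_parity (g : Fin 2 → ℝ) (n : ℕ) :
    ∑ k ∈ Finset.range n, g (parity k) =
      (((n + 1) / 2 : ℕ) : ℝ) * g 0 + ((n / 2 : ℕ) : ℝ) * g 1 := by
  induction n with
  | zero => simp
  | succ n ih =>
    rw [Finset.sum_range_succ, ih]
    rcases Nat.even_or_odd' n with ⟨m, rfl | rfl⟩
    · have h1 : parity (2 * m) = 0 := by ext; simp [parity]
      have h2 : (2 * m + 1 + 1) / 2 = m + 1 := by omega
      have h3 : (2 * m + 1) / 2 = m := by omega
      have h4 : (2 * m) / 2 = m := by omega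
      rw [h1, h2, h3, h4]
      push_cast
      ring
    · have h1 : parity (2 * m + 1) = 1 := by ext; simp [parity, Nat.add_mod]
      have h2 : (2 * m + 1 + 1 + 1) / 2 = m + 1 := by omega
      have h3 : (2 * m + 1 + 1) / 2 = m + 1 := by omega
      have h4 : (2 * m + 1) / 2 = m := by omega
      rw [h1, h2, h3, h4]
      push_cast
      ring

lemma tendsto_natCast_add_div_two_div (j : ℕ) :
    Tendsto (fun n : ℕ => (((n + j) / 2 : ℕ) : ℝ) / n) atTop (𝓝 (1 / 2)) := by
  have hinv : Tendsto (fun n : ℕ => ((j : ℝ) + 1) / n) atTop (𝓝 0) :=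
    tendsto_const_div_atTop_nhds_zero_nat _
  have hlow := (tendsto_const_nhds (x := (1 / 2 : ℝ))).sub hinv
  have hupp := (tendsto_const_nhds (x := (1 / 2 : ℝ))).add hinv
  rw [sub_zero] at hlow
  rw [add_zero] at hupp
  refine tendsto_of_tendsto_of_tendsto_of_le_of_le' hlow hupp ?_ ?_ <;>
    filter_upwards [eventually_gt_atTop 0] with n hn
  · have hn' : (0 : ℝ) < n := by exact_mod_cast hn
    rw [le_div_iff₀ hn', sub_mul, div_mul_cancel₀ _ hn'.ne']
    have h : (n : ℝ) + j ≤ 2 * ((n + j) / 2 : ℕ) + 1 := by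
      exact_mod_cast (by omega : n + j ≤ 2 * ((n + j) / 2) + 1)
    have : (0 : ℝ) ≤ j := j.cast_nonneg
    linarith
  · have hn' : (0 : ℝ) < n := by exact_mod_cast hn
    rw [div_le_iff₀ hn', add_mul, div_mul_cancel₀ _ hn'.ne']
    have h : 2 * (((n + j) / 2 : ℕ) : ℝ) ≤ n + j := by
      exact_mod_cast (by omega : 2 * ((n + j) / 2) ≤ n + j)
    have : (0 : ℝ) ≤ j := j.cast_nonneg
    linarith

/-- The displacement from a vertex of class `i`, paired with `l` and centred. -/
def centredStep (a : ℝ) (q : Fin 2 → Fin 3 → ℝ) (l : ℝ × ℝ) (i : Fin 2) (r : Fin 3) : ℝ :=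
  pairing l (hexStep a i r) - ∑ r', q i r' * pairing l (hexStep a i r')

lemma sum_mul_centredStep (a : ℝ) {q : Fin 2 → Fin 3 → ℝ} (hq : ∀ i, ∑ r, q i r = 1) (l : ℝ × ℝ)
    (i : Fin 2) : ∑ r, q i r * centredStep a q l i r = 0 := by
  simp only [centredStep, mul_sub, Finset.sum_sub_distrib, ← Finset.sum_mul, hq, one_mul, sub_self]

/-- `covMatrix` is the average of the covariance matrices of the two step laws; the inner factors
1/2 belong to the half-variances. -/
lemma quadForm_covMatrix (a : ℝ) {q : Fin 2 → Fin 3 → ℝ} (hq : ∀ i, ∑ r, q i r = 1) (l : ℝ × ℝ) :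
    quadForm (covMatrix a q) l =
      1 / 2 * (1 / 2 * ∑ r, q 0 r * centredStep a q l 0 r ^ 2) +
      1 / 2 * (1 / 2 * ∑ r, q 1 r * centredStep a q l 1 r ^ 2) := by
  have h0 := hq 0
  have h1 := hq 1
  rw [Fin.sum_univ_three] at h0 h1
  have e0 : q 0 0 = 1 - q 0 1 - q 0 2 := by linarith
  have e1 : q 1 0 = 1 - q 1 1 - q 1 2 := by linarith
  have h3 : √3 ^ 2 = (3 : ℝ) := Real.sq_sqrt (by norm_num)
  simp only [quadForm, covMatrix, centredStep, hexStep_one, hexStep_zero, Fin.sum_univ_three,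
    pairing, Matrix.mulVec, dotProduct, Fin.sum_univ_two, Matrix.of_apply, Matrix.cons_val_zero,
    Matrix.cons_val_one, Matrix.cons_val, Prod.fst_neg, Prod.snd_neg, sigmaSqX, sigmaSqY, sigmaXY,
    e0, e1]
  -- Only w² = 3 matters, so the identity becomes polynomial.
  generalize √3 = w at h3
  ring_nf
  simp only [h3]
  ring

section walk

variable {Ω : Type*} [MeasurableSpace Ω] {P : Measure Ω} [IsProbabilityMeasure P]
  {a : ℝ} {q : Fin 2 → Fin 3 → ℝ} {X Y : ℕ → Ω → ℝ}

/-- The moment generating function of the centred walk. -/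
lemma integral_exp_centred_walk (ha : 0 < a) (hq : ∀ i r, 0 ≤ q i r) (hq1 : ∀ i, ∑ r, q i r = 1)
    (h : IsHexWalk P a q X Y) (n : ℕ) (l : ℝ × ℝ) (s : ℝ) :
    ∫ ω, Real.exp (s * pairing l (X n ω - ∫ ω', X n ω' ∂P, Y n ω - ∫ ω', Y n ω' ∂P)) ∂P =
      ∏ k ∈ Finset.range n, ∑ r, q (parity k) r * Real.exp (s * centredStep a q l (parity k) r) := by
  have hX := integrable_and_integral_eq_walkExpect ha hq hq1 h n Prod.fst
  have hY := integrable_and_integral_eq_walkExpect ha hq hq1 h n Prod.snd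
  have hmean : pairing l (∫ ω', X n ω' ∂P, ∫ ω', Y n ω' ∂P) =
      ∑ k ∈ Finset.range n, ∑ r, q (parity k) r * pairing l (hexStep a (parity k) r) := by
    rw [← walkExpect_pairing a hq1,
      ← (integrable_and_integral_eq_walkExpect ha hq hq1 h n (pairing l)).2]
    simp only [pairing]
    rw [integral_add (hX.1.const_mul _) (hY.1.const_mul _), integral_const_mul, integral_const_mul]
  have hsplit : ∀ ω, Real.exp (s * pairing l (X n ω - ∫ ω', X n ω' ∂P, Y n ω - ∫ ω', Y n ω' ∂P)) =
      Real.exp (s * pairing l (X n ω, Y n ω)) *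
        Real.exp (-(s * pairing l (∫ ω', X n ω' ∂P, ∫ ω', Y n ω' ∂P))) := by
    intro ω
    rw [← Real.exp_add]
    congr 1
    simp only [pairing]
    ring
  simp only [hsplit]
  rw [integral_mul_const, (integrable_and_integral_eq_walkExpect ha hq hq1 h n
    (fun z => Real.exp (s * pairing l z))).2, walkExpect_exp_pairing, hmean, Finset.mul_sum,
    ← Finset.sum_neg_distrib, Real.exp_sum, ← Finset.prod_mul_distrib]
  refine Finset.prod_congr rfl fun k _ => ?_
  rw [Finset.sum_mul]
  refine Finset.sum_congr rfl fun r _ => ?_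
  rw [mul_assoc, ← Real.exp_add]
  congr 2
  simp only [centredStep]
  ring

/-- Since b n = 1/(n σ²), the expression is the sum over i of (number of steps from class i)/n times
(log of the i-th factor)/σ²; the proportions tend to 1/2. -/
lemma tendsto_log_mgf_walk (hq : ∀ i r, 0 ≤ q i r) (hq1 : ∀ i, ∑ r, q i r = 1)
    {b : ℕ → ℝ} (hb : Tendsto (fun n : ℕ => (n : ℝ) * b n) atTop atTop) (l : ℝ × ℝ) :
    Tendsto (fun n : ℕ => b n * Real.log (∏ k ∈ Finset.range n, ∑ r, q (parity k) r *
      Real.exp ((√((n : ℝ) * b n))⁻¹ * centredStep a q l (parity k) r))) atTop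
      (𝓝 (quadForm (covMatrix a q) l)) := by
  set σ : ℕ → ℝ := fun n => (√((n : ℝ) * b n))⁻¹ with hσ
  have hσ0 : Tendsto σ atTop (𝓝[≠] 0) := by
    refine tendsto_nhdsWithin_iff.2
      ⟨tendsto_inv_atTop_zero.comp (Real.tendsto_sqrt_atTop.comp hb), ?_⟩
    filter_upwards [hb.eventually_gt_atTop 0] with n hn
    exact (inv_pos.2 (Real.sqrt_pos.2 hn)).ne'
  have hg : ∀ i, Tendsto (fun n => Real.log (∑ r, q i r * Real.exp (σ n * centredStep a q l i r)) /
      σ n ^ 2) atTop (𝓝 (1 / 2 * ∑ r, q i r * centredStep a q l i r ^ 2)) := fun i =>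
    (tendsto_log_sum_exp_div_sq (hq1 i) (sum_mul_centredStep a hq1 l i)).comp hσ0
  have hlim := ((tendsto_natCast_add_div_two_div 1).mul (hg 0)).add
    ((tendsto_natCast_add_div_two_div 0).mul (hg 1))
  rw [quadForm_covMatrix a hq1]
  refine hlim.congr' ?_
  filter_upwards [hb.eventually_gt_atTop 0, eventually_gt_atTop 0] with n hn hn0
  have hpos : ∀ i, (∑ r, q i r * Real.exp (σ n * centredStep a q l i r)) ≠ 0 := by
    intro i
    obtain ⟨r, -, hr⟩ : ∃ r ∈ Finset.univ, 0 < q i r := by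
      by_contra! hcon
      have := Finset.sum_nonpos hcon
      rw [hq1] at this
      linarith
    exact (Finset.sum_pos' (fun r _ => mul_nonneg (hq i r) (Real.exp_pos _).le)
      ⟨r, Finset.mem_univ r, mul_pos hr (Real.exp_pos _)⟩).ne'
  rw [Real.log_prod fun k _ => hpos (parity k), sum_range_parity
    fun i => Real.log (∑ r, q i r * Real.exp (σ n * centredStep a q l i r))]
  have hσ2 : σ n ^ 2 = ((n : ℝ) * b n)⁻¹ := by
    rw [hσ]
    simp only [inv_pow, Real.sq_sqrt hn.le]
  have hn1 : (n : ℝ) ≠ 0 := by exact_mod_cast hn0.ne'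
  rw [hσ2]
  simp only [div_inv_eq_mul, add_zero]
  field_simp

end walk

end

theorem proposition6 {Ω : Type*} [MeasurableSpace Ω] (P : Measure Ω) [IsProbabilityMeasure P]
    (a : ℝ) (ha : 0 < a)
    (q : Fin 2 → Fin 3 → ℝ) (hq_nonneg : ∀ i r, 0 ≤ q i r) (hq_sum : ∀ i, ∑ r, q i r = 1)
    (X Y : ℕ → Ω → ℝ) (hXY : IsHexWalk P a q X Y)
    (b : ℕ → ℝ) (hb_pos : ∀ n, 1 ≤ n → 0 < b n)
    (hb_zero : Tendsto b atTop (𝓝 0))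
    (hb_infty : Tendsto (fun n : ℕ => (n : ℝ) * b n) atTop atTop) :
    SatisfiesLDP P
      (fun (n : ℕ) (ω : Ω) =>
        √((n : ℝ) * b n) • ((X n ω - ∫ ω', X n ω' ∂P) / n, (Y n ω - ∫ ω', Y n ω' ∂P) / n))
      (fun n => 1 / b n)
      (legendre (quadForm (covMatrix a q))) ∧
    IsGoodRateFunction (legendre (quadForm (covMatrix a q))) := by
  refine satisfiesLDP_of_tendsto_log_mgf (fun n => ?_) hb_pos hb_zero (fun l n => ?_) fun l => ?_
  · have hX := hXY.measurable_fst n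
    have hY := hXY.measurable_snd n
    simp only [Prod.smul_mk]
    fun_prop
  -- Integrability holds for every function of the position, hence also at n = 0, where `b` is
  -- unconstrained.
  · exact (integrable_and_integral_eq_walkExpect ha hq_nonneg hq_sum hXY n fun z =>
      Real.exp (pairing l (√((n : ℝ) * b n) • ((z.1 - ∫ ω', X n ω' ∂P) / n,
        (z.2 - ∫ ω', Y n ω' ∂P) / n)) / b n)).1
  · refine (tendsto_log_mgf_walk hq_nonneg hq_sum hb_infty l).congr' ?_
    filter_upwards [hb_infty.eventually_gt_atTop 0, eventually_ge_atTop 1] with n hn hn1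
    rw [← integral_exp_centred_walk ha hq_nonneg hq_sum hXY]
    -- The integrands agree because √(n b n)/(n b n) = 1/√(n b n).
    congr 4 with ω
    congr 1
    have hb := hb_pos n hn1
    have hn0 : (n : ℝ) ≠ 0 := by positivity
    have hs : √((n : ℝ) * b n) ≠ 0 := (Real.sqrt_pos.2 hn).ne'
    have hsq : √((n : ℝ) * b n) ^ 2 = n * b n := Real.sq_sqrt hn.le
    simp only [pairing, Prod.smul_mk, smul_eq_mul]
    field_simp
    rw [hsq]
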